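/- \textbf{Setting.} Order $\mathbb{R}^n$ coordinatewise and write $[\mathbf p,\mathbf q]=\{\mathbf x:\mathbf p\preceq\mathbf x\preceq\mathbf q\}$. An \emph{elementary cube} is an interval $[\mathbf p,\mathbf q]$ with $\mathbf p,\mathbf q\in\mathbb{Z}^n$ and $\mathbf q-\mathbf p\in\{0,1\}^n$. A \emph{Euclidean cubical complex} $K\subseteq\mathbb{R}^n$ is a union of elementary cubes; its set of vertices is $K_0=K\cap\mathbb{Z}^n$. A \emph{dipath} in $K$ is a continuous map $[0,1]\to K$ all of whose coordinates are non-decreasing, and $\vec P_{\mathbf x}^{\mathbf y}(K)$ is the set of dipaths in $K$ from $\mathbf x$ to $\mathbf y$ with the compact-open topology. A point of $K$ is \emph{reachable} from $\mathbf w\in K_0$ if there is a dipath in $K$ from $\mathbf w$ to it; the \emph{subcomplex reachable from} $\mathbf w$ is the union of the elementary cubes all of whose points are reachable from $\mathbf w$. The \emph{past link} $lk^-_{K,\mathbf w}(\mathbf v)$ is the simplicial complex with vertices in $\{1,\dots,n\}$ whose simplices are the nonempty subsets $S$ such that, with $\mathbf j\in\{0,1\}^n$ the indicator vector of $S$, $[\mathbf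 v-\mathbf j,\mathbf v]\subseteq K\cap[\mathbf w,\mathbf v]$; its topology is that of its geometric realization. A space is \emph{disconnected} if it is the union of two disjoint nonempty open subsets; in particular the empty space is not disconnected. \textbf{Theorem (Realizing Obstructions).} Let $K\subseteq\mathbb{R}^n$ be a Euclidean cubical complex with $\mathbf 0\in K_0$, and let $\hat K\subseteq K$ be the subcomplex reachable from $\mathbf 0$. If $\mathbf v\in\hat K_0$ is a vertex for which the past link $lk^-_{\hat K,\mathbf 0}(\mathbf v)$ is disconnected, then the path space $\vec P_{\mathbf 0}^{\mathbf v}(K)$ is disconnected. -/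

import Mathlib

/-- An elementary cube in `ℝⁿ`: an interval `[p, q]` for the coordinatewise order, where
`p, q ∈ ℤⁿ` and `q - p ∈ {0,1}ⁿ`. -/
def IsElementaryCube {n : ℕ} (C : Set (Fin n → ℝ)) : Prop :=
  ∃ p q : Fin n → ℤ, (∀ i, q i - p i = 0 ∨ q i - p i = 1) ∧
    C = Set.Icc (fun i => (p i : ℝ)) (fun i => (q i : ℝ))

/-- A Euclidean cubical complex in `ℝⁿ`: a union of (possibly infinitely many) elementary cubes. -/
def IsEuclideanCubicalComplex {n : ℕ} (K : Set (Fin n → ℝ)) : Prop :=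
  ∃ 𝒞 : Set (Set (Fin n → ℝ)), (∀ C ∈ 𝒞, IsElementaryCube C) ∧ K = ⋃₀ 𝒞

/-- The vertices `K₀` of a Euclidean cubical complex: the points of `K` with integer coordinates,
that is, the `0`-dimensional elementary cubes contained in `K`. -/
def cubicalVertices {n : ℕ} (K : Set (Fin n → ℝ)) : Set (Fin n → ℝ) :=
  {v | v ∈ K ∧ ∃ p : Fin n → ℤ, v = fun i => (p i : ℝ)}

/-- The dipaths of `K`, with the directed structure inherited from directed Euclidean space: the
continuous paths `[0,1] → K` all of whose coordinates are non-decreasing. As a subset of the space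
`C([0,1], K)` it carries the compact-open topology. -/
def dipaths {n : ℕ} (K : Set (Fin n → ℝ)) : Set C(unitInterval, K) :=
  {γ | ∀ i, Monotone fun t => (γ t : Fin n → ℝ) i}

/-- The space of directed paths in `K` from `x` to `y`, as a subset of `C([0,1], K)` with the
compact-open topology. -/
def dipathSpace {n : ℕ} (K : Set (Fin n → ℝ)) (x y : Fin n → ℝ) : Set C(unitInterval, K) :=
  {γ | γ ∈ dipaths K ∧ (γ 0 : Fin n → ℝ) = x ∧ (γ 1 : Fin n → ℝ) = y}

/-- The point `x` is reachable from `w` in `K`: there is a dipath in `K` from `w` to `x`. -/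
def IsReachable {n : ℕ} (K : Set (Fin n → ℝ)) (w x : Fin n → ℝ) : Prop :=
  (dipathSpace K w x).Nonempty

/-- The subcomplex of `K` reachable from `w`: the union of the elementary cubes all of whose points
are reachable from `w` in `K`. -/
def reachableSubcomplex {n : ℕ} (K : Set (Fin n → ℝ)) (w : Fin n → ℝ) : Set (Fin n → ℝ) :=
  ⋃₀ {C | IsElementaryCube C ∧ ∀ x ∈ C, IsReachable K w x}

/-- The reachable subcomplex is a Euclidean cubical complex. -/
theorem isEuclideanCubicalComplex_reachableSubcomplex {n : ℕ} (K : Set (Fin n → ℝ))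
    (w : Fin n → ℝ) : IsEuclideanCubicalComplex (reachableSubcomplex K w) :=
  ⟨_, fun _ hC => hC.1, rfl⟩

/-- The reachable subcomplex of `K` is contained in `K`. -/
theorem reachableSubcomplex_subset {n : ℕ} (K : Set (Fin n → ℝ)) (w : Fin n → ℝ) :
    reachableSubcomplex K w ⊆ K := by
  rintro x ⟨C, ⟨-, hC⟩, hx⟩
  obtain ⟨γ, -, -, h1⟩ := hC x hx
  exact h1 ▸ (γ 1).2

/-- The element of `{0,1}ⁿ` corresponding to a subset of `{1, …, n}`. -/
def zeroOneVector {n : ℕ} (s : Finset (Fin n)) : Fin n → ℝ :=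
  fun i => if i ∈ s then 1 else 0

/-- The past link of `v` in `K` with respect to `w`: the simplicial complex with vertices in
`{1, …, n}` in which a nonempty `s`, with corresponding `j ∈ {0,1}ⁿ`, is a simplex if and only if
`[v - j, v] ⊆ K ∩ [w, v]`. -/
def pastLink {n : ℕ} (K : Set (Fin n → ℝ)) (w v : Fin n → ℝ) :
    PreAbstractSimplicialComplex (Fin n) where
  faces := {s | s.Nonempty ∧ Set.Icc (v - zeroOneVector s) v ⊆ K ∩ Set.Icc w v}
  isRelLowerSet_faces := by
    rintro s ⟨hs, hsK⟩
    refine ⟨hs, fun t hts ht => ⟨ht, subset_trans (Set.Icc_subset_Icc_left ?_) hsK⟩⟩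
    refine sub_le_sub_left (fun i => ?_) v
    have hst : i ∈ t → i ∈ s := fun h => hts h
    by_cases h1 : i ∈ t
    · simp [zeroOneVector, h1, hst h1]
    · by_cases h2 : i ∈ s <;> simp [zeroOneVector, h1, h2]

/-- The geometric realization of a finite simplicial complex with vertices in `{1, …, n}`: the
points of the standard simplex whose support is contained in a simplex of the complex. -/
def geometricRealization {n : ℕ} (L : PreAbstractSimplicialComplex (Fin n)) : Set (Fin n → ℝ) :=
  {x | x ∈ stdSimplex ℝ (Fin n) ∧ ∃ s ∈ L, ∀ i, i ∉ s → x i = 0}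

/-! At a time when a dipath to `v` is strictly above `v - 1` but not yet at `v`, the carrier of its
position is a cube with top vertex `v`, so the unfinished coordinates form a simplex of the past
link (`mem_pastLink_of_dipath`). That this cube lies in the reachable subcomplex rests on
`IsReachable.floor`.

A disconnected link splits its vertices into classes `A` and `B` with no simplex meeting both. By
monotonicity the unfinished set only shrinks with time, so a dipath cannot approach `v` through both
classes. The two kinds of approach therefore give disjoint, nonempty open sets covering the path
space. -/

open unitInterval in
/-- A dipath to `a` extends along the segment to `b` inside the order interval `[a, b] ⊆ K`;
the extended dipath passes through the midpoint of the segment. -/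
theorem exists_dipath_extend {n : ℕ} {K : Set (Fin n → ℝ)} {w a b : Fin n → ℝ}
    (ha : IsReachable K w a) (hab : a ≤ b) (hK : Set.Icc a b ⊆ K) :
    ∃ δ ∈ dipathSpace K w b, ∃ t, ∀ i, (δ t : Fin n → ℝ) i = (a i + b i) / 2 := by
  obtain ⟨γ, hγ, h0, h1⟩ := ha
  -- `projIcc` holds `γ` at `a` once t ≥ 1/2, and the `max` removes the segment term before that.
  -- The midpoint is reached at t = 3/4.
  let f : I → Fin n → ℝ := fun t i =>
    (γ (Set.projIcc 0 1 zero_le_one (2 * (t : ℝ))) : Fin n → ℝ) i +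
      max (2 * (t : ℝ) - 1) 0 * (b i - a i)
  have hf : Continuous f := by
    refine continuous_pi fun i => ?_
    have h2 : Continuous fun t : I => γ (Set.projIcc 0 1 zero_le_one (2 * (t : ℝ))) :=
      γ.continuous.comp (continuous_projIcc.comp (by fun_prop))
    exact ((continuous_apply i).comp (continuous_subtype_val.comp h2)).add (by fun_prop)
  have hhigh : ∀ t : I, 1 ≤ 2 * (t : ℝ) →
      ∀ i, f t i = a i + (2 * (t : ℝ) - 1) * (b i - a i) := by
    intro t ht i
    have h3 : Set.projIcc (0 : ℝ) 1 zero_le_one (2 * (t : ℝ)) = 1 := Set.projIcc_of_right_le _ ht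
    simp only [f]
    rw [h3, h1, max_eq_left (by linarith)]
  have hmem : ∀ t, f t ∈ K := by
    intro t
    rcases le_total (2 * (t : ℝ)) 1 with ht | ht
    · have : f t = γ (Set.projIcc 0 1 zero_le_one (2 * (t : ℝ))) := by
        funext i
        simp only [f]
        rw [max_eq_right (by linarith)]
        ring
      rw [this]
      exact (γ _).2
    · have ht1 := t.2.2
      refine hK ⟨fun i => ?_, fun i => ?_⟩ <;> rw [hhigh t ht i] <;>
        nlinarith [hab i]
  refine ⟨⟨fun t => ⟨f t, hmem t⟩, hf.subtype_mk _⟩, ⟨fun i s t hst => ?_, ?_, ?_⟩,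
    ⟨3 / 4, by norm_num, by norm_num⟩, fun i => ?_⟩
  · have hst' : 2 * (s : ℝ) ≤ 2 * (t : ℝ) := by
      have : (s : ℝ) ≤ t := hst
      linarith
    refine add_le_add (hγ i (Set.monotone_projIcc _ hst'))
      (mul_le_mul_of_nonneg_right (max_le_max_right _ (by linarith)) (sub_nonneg.2 (hab i)))
  · funext i
    simp [f, h0]
  · funext i
    change f 1 i = b i
    rw [hhigh 1 (by norm_num) i]
    norm_num
  · change f _ i = _
    rw [hhigh _ (by norm_num) i]
    ring

theorem IsReachable.extend {n : ℕ} {K : Set (Fin n → ℝ)} {w a b : Fin n → ℝ}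
    (ha : IsReachable K w a) (hab : a ≤ b) (hK : Set.Icc a b ⊆ K) : IsReachable K w b :=
  let ⟨δ, hδ, _⟩ := exists_dipath_extend ha hab hK
  ⟨δ, hδ⟩

theorem isReachable_self {n : ℕ} {K : Set (Fin n → ℝ)} {w : Fin n → ℝ} (hw : w ∈ K) :
    IsReachable K w w :=
  ⟨ContinuousMap.const _ ⟨w, hw⟩, fun _ _ _ _ => le_rfl, rfl, rfl⟩

open unitInterval in
/-- Every point of a dipath is reachable from its start. -/
theorem isReachable_apply {n : ℕ} {K : Set (Fin n → ℝ)} {w x : Fin n → ℝ}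
    {γ : C(I, K)} (hγ : γ ∈ dipathSpace K w x) (t : I) : IsReachable K w (γ t) := by
  obtain ⟨hm, h0, -⟩ := hγ
  refine ⟨γ.comp ⟨fun s => s * t, by fun_prop⟩, fun i a b hab => hm i ?_, ?_, ?_⟩
  · exact mul_le_mul_of_nonneg_right (α := ℝ) hab t.2.1
  · simpa using h0
  · simp

theorem IsReachable.le {n : ℕ} {K : Set (Fin n → ℝ)} {w x : Fin n → ℝ}
    (hx : IsReachable K w x) : w ≤ x := by
  obtain ⟨γ, hm, h0, h1⟩ := hx
  intro i
  rw [← h0, ← h1]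
  exact hm i zero_le_one

/-- A path that ends above `m` but does not start above `m` has a point that is not above `m`
although all its coordinates exceed those of `m - 1`. -/
theorem exists_apply_near {n : ℕ} {K : Set (Fin n → ℝ)} (γ : C(unitInterval, K))
    {m : Fin n → ℝ} (h0 : ∃ i, (γ 0 : Fin n → ℝ) i < m i) (h1 : m ≤ γ 1) :
    ∃ t, (∀ i, m i - 1 < (γ t : Fin n → ℝ) i) ∧ ∃ i, (γ t : Fin n → ℝ) i < m i := by
  -- Total deficit below `m`. A value in (0, 1/2] forces each single deficit below 1 and at least
  -- one to be positive.
  let f : unitInterval → ℝ := fun t => ∑ i, max 0 (m i - (γ t : Fin n → ℝ) i)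
  have hf : Continuous f := by
    refine continuous_finsetSum _ fun i _ => continuous_const.max (continuous_const.sub ?_)
    exact (continuous_apply i).comp (continuous_subtype_val.comp γ.continuous)
  have hf0 : 0 < f 0 := by
    obtain ⟨i, hi⟩ := h0
    exact Finset.sum_pos' (fun _ _ => le_max_left _ _)
      ⟨i, Finset.mem_univ i, lt_max_of_lt_right (sub_pos.2 hi)⟩
  have hf1 : f 1 = 0 := Finset.sum_eq_zero fun i _ => max_eq_left (sub_nonpos.2 (h1 i))
  obtain ⟨t, ht⟩ : min (f 0) (1 / 2) ∈ Set.range f :=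
    intermediate_value_univ 1 0 hf ⟨by rw [hf1]; positivity, min_le_left _ _⟩
  refine ⟨t, fun i => ?_, ?_⟩
  · have h2 : max 0 (m i - (γ t : Fin n → ℝ) i) ≤ f t :=
      Finset.single_le_sum (f := fun i => max 0 (m i - (γ t : Fin n → ℝ) i))
        (fun _ _ => le_max_left _ _) (Finset.mem_univ i)
    have h3 := le_max_right 0 (m i - (γ t : Fin n → ℝ) i)
    have h4 := min_le_right (f 0) (1 / 2)
    linarith
  · by_contra! h
    have h2 : f t = 0 := Finset.sum_eq_zero fun i _ => max_eq_left (sub_nonpos.2 (h i))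
    have h3 : 0 < min (f 0) (1 / 2) := by positivity
    linarith

/-- A cubical complex contains the carrier of each of its points. -/
theorem IsEuclideanCubicalComplex.carrier_subset {n : ℕ} {K : Set (Fin n → ℝ)}
    (hK : IsEuclideanCubicalComplex K) {x : Fin n → ℝ} (hx : x ∈ K) :
    Set.Icc (fun i => (⌊x i⌋ : ℝ)) (fun i => (⌈x i⌉ : ℝ)) ⊆ K := by
  obtain ⟨𝒞, h𝒞, rfl⟩ := hK
  obtain ⟨C, hC, hxC⟩ := hx
  obtain ⟨p, q, -, rfl⟩ := h𝒞 C hC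
  refine (Set.Icc_subset_Icc (fun i => ?_) fun i => ?_).trans (Set.subset_sUnion_of_mem hC)
  · exact Int.cast_le.2 (Int.le_floor.2 (hxC.1 i))
  · exact Int.cast_le.2 (Int.ceil_le.2 (hxC.2 i))

/-- The lowest vertex of the carrier of a reachable point is reachable. -/
theorem IsReachable.floor {n : ℕ} {K : Set (Fin n → ℝ)} (hK : IsEuclideanCubicalComplex K)
    {x : Fin n → ℝ} (hx : IsReachable K 0 x) : IsReachable K 0 fun i => (⌊x i⌋ : ℝ) := by
  -- Step back along the dipath to a point whose floor is smaller but whose carrier still contains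
  -- `⌊x⌋`; then extend from its floor to `⌊x⌋` inside that carrier.
  induction h : ∑ i, ⌊x i⌋.toNat using Nat.strong_induction_on generalizing x with
  | _ N ih =>
    subst h
    have hx0 := hx.le
    obtain ⟨γ, hγ⟩ := hx
    have hm := hγ.1
    have h0 := hγ.2.1
    have h1 := hγ.2.2
    by_cases hz : ∃ i, (0 : ℝ) < ⌊x i⌋
    · obtain ⟨t, ht, i, hi⟩ := exists_apply_near γ (m := fun i => (⌊x i⌋ : ℝ)) (by simpa [h0] using hz)
        (by rw [h1]; exact fun i => Int.floor_le _)
      have hle : ∀ j, ⌊(γ t : Fin n → ℝ) j⌋ ≤ ⌊x j⌋ := fun j => by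
        rw [← h1]
        exact Int.floor_le_floor (hm j t.2.2)
      have hpos : ∀ j, 0 ≤ (γ t : Fin n → ℝ) j := (isReachable_apply hγ t).le
      refine (ih _ (Finset.sum_lt_sum (fun j _ => Int.toNat_le_toNat (hle j))
        ⟨i, Finset.mem_univ i, ?_⟩) (isReachable_apply hγ t) rfl).extend
        (fun j => Int.cast_le.2 (hle j)) ((Set.Icc_subset_Icc_right fun j => ?_).trans
          (hK.carrier_subset (γ t).2))
      · have h2 : ⌊(γ t : Fin n → ℝ) i⌋ < ⌊x i⌋ := Int.floor_lt.2 hi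
        have h3 : 0 ≤ ⌊(γ t : Fin n → ℝ) i⌋ := Int.floor_nonneg.2 (hpos i)
        omega
      · have h2 : ⌊x j⌋ - 1 < ⌈(γ t : Fin n → ℝ) j⌉ :=
          Int.lt_ceil.2 (by push_cast; exact ht j)
        exact Int.cast_le.2 (by omega)
    · push Not at hz
      have h2 : (fun i => (⌊x i⌋ : ℝ)) = 0 := funext fun i =>
        le_antisymm (hz i) (Int.cast_nonneg (Int.floor_nonneg.2 (hx0 i)))
      rw [h2]
      exact isReachable_self (h0 ▸ (γ 0).2)

open Classical in
/-- If a point of a dipath from `0` to a vertex `v` lies strictly above `v - 1`, then the set of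
its coordinates that differ from those of `v`, when nonempty, is a simplex of the past link. -/
theorem mem_pastLink_of_dipath {n : ℕ} {K : Set (Fin n → ℝ)} (hK : IsEuclideanCubicalComplex K)
    {p : Fin n → ℤ} {γ : C(unitInterval, K)} (hγ : γ ∈ dipathSpace K 0 fun i => (p i : ℝ))
    {t : unitInterval} (ht : ∀ i, (p i : ℝ) - 1 < (γ t : Fin n → ℝ) i)
    (hlt : ∃ i, (γ t : Fin n → ℝ) i < p i) :
    (Finset.univ.filter fun i => (γ t : Fin n → ℝ) i < p i) ∈
      pastLink (reachableSubcomplex K 0) 0 fun i => (p i : ℝ) := by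
  have hr := isReachable_apply hγ t
  have hle : ∀ i, (γ t : Fin n → ℝ) i ≤ p i := fun i => by
    rw [← congrFun hγ.2.2 i]
    exact hγ.1 i t.2.2
  have hceil : ∀ i, ⌈(γ t : Fin n → ℝ) i⌉ = p i := fun i => Int.ceil_eq_iff.2 ⟨ht i, hle i⟩
  have hfloor : ((fun i => (p i : ℝ)) -
      zeroOneVector (Finset.univ.filter fun i => (γ t : Fin n → ℝ) i < p i)) =
      fun i => (⌊(γ t : Fin n → ℝ) i⌋ : ℝ) := by
    funext i
    by_cases h : (γ t : Fin n → ℝ) i < p i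
    · have : ⌊(γ t : Fin n → ℝ) i⌋ = p i - 1 :=
        Int.floor_eq_iff.2 ⟨by push_cast; exact (ht i).le, by push_cast; linarith⟩
      simp [zeroOneVector, h, this]
    · have : ⌊(γ t : Fin n → ℝ) i⌋ = p i := by
        rw [le_antisymm (hle i) (not_lt.1 h), Int.floor_intCast]
      simp [zeroOneVector, h, this]
  have hcube := hK.carrier_subset (γ t).2
  simp only [hceil] at hcube
  have hreach : ∀ y ∈ Set.Icc (fun i => (⌊(γ t : Fin n → ℝ) i⌋ : ℝ)) (fun i => (p i : ℝ)),
      IsReachable K 0 y := fun y hy =>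
    (hr.floor hK).extend hy.1 ((Set.Icc_subset_Icc_right hy.2).trans hcube)
  refine ⟨hlt.imp fun i hi => by simpa using hi, ?_⟩
  rw [hfloor]
  refine fun y hy => ⟨⟨_, ⟨⟨fun i => ⌊(γ t : Fin n → ℝ) i⌋, p, fun i => ?_, rfl⟩, hreach⟩, hy⟩,
    (hreach y hy).le, hy.2⟩
  have h1 := Int.ceil_le_floor_add_one ((γ t : Fin n → ℝ) i)
  have h2 := Int.floor_le_ceil ((γ t : Fin n → ℝ) i)
  rw [hceil] at h1 h2
  dsimp only
  omega

/-- If the geometric realization is not preconnected, then its vertices split into two nonempty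
classes such that no simplex meets both. -/
theorem exists_vertex_separation {n : ℕ} {L : PreAbstractSimplicialComplex (Fin n)}
    (hL : ¬ IsPreconnected (geometricRealization L)) :
    ∃ A B : Set (Fin n), (∃ i ∈ A, {i} ∈ L) ∧ (∃ i ∈ B, {i} ∈ L) ∧
      ∀ s ∈ L, (∀ i ∈ s, i ∈ A ∨ i ∈ B) ∧ ∀ i ∈ s, ∀ j ∈ s, i ∈ A → j ∉ B := by
  simp only [IsPreconnected, not_forall] at hL
  obtain ⟨U, V, hU, hV, hUV, hneU, hneV, hdisj⟩ := hL
  let F : Finset (Fin n) → Set (Fin n → ℝ) := fun s =>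
    {x | x ∈ stdSimplex ℝ (Fin n) ∧ ∀ i, i ∉ s → x i = 0}
  have hFsub : ∀ s ∈ L, F s ⊆ geometricRealization L := fun s hs x hx => ⟨hx.1, s, hs, hx.2⟩
  have hFconv : ∀ s, Convex ℝ (F s) := by
    intro s x hx y hy a b ha hb hab
    refine ⟨convex_stdSimplex ℝ (Fin n) hx.1 hy.1 ha hb hab, fun i hi => ?_⟩
    simp [hx.2 i hi, hy.2 i hi]
  have hvert : ∀ s, ∀ i ∈ s, (Pi.single i 1 : Fin n → ℝ) ∈ F s := fun s i hi =>
    ⟨single_mem_stdSimplex ℝ i, fun j hj => Pi.single_eq_of_ne (by rintro rfl; exact hj hi) _⟩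
  -- A closed face is convex, hence connected, so it cannot meet both sides.
  have hnot : ∀ s ∈ L, ∀ x ∈ F s, ∀ y ∈ F s, x ∈ U → y ∉ V := by
    intro s hs x hx y hy hxU hyV
    obtain ⟨z, hz, hz'⟩ := (hFconv s).isPreconnected U V hU hV ((hFsub s hs).trans hUV)
      ⟨x, hx, hxU⟩ ⟨y, hy, hyV⟩
    exact hdisj ⟨z, hFsub s hs hz, hz'⟩
  have hcover : ∀ s ∈ L, ∀ i ∈ s,
      (Pi.single i 1 : Fin n → ℝ) ∈ U ∨ (Pi.single i 1 : Fin n → ℝ) ∈ V :=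
    fun s hs i hi => hUV (hFsub s hs (hvert s i hi))
  have hsing : ∀ s ∈ L, ∀ i ∈ s, {i} ∈ L := fun s hs i hi =>
    (L.isRelLowerSet_faces hs).2 (Finset.singleton_subset_iff.2 hi) (Finset.singleton_nonempty i)
  refine ⟨{i | Pi.single i 1 ∈ U}, {i | Pi.single i 1 ∈ V}, ?_, ?_, fun s hs =>
    ⟨hcover s hs, fun i hi j hj => hnot s hs _ (hvert s i hi) _ (hvert s j hj)⟩⟩
  · obtain ⟨x, ⟨hx, s, hs, hxs⟩, hxU⟩ := hneU
    obtain ⟨i, hi⟩ := (L.isRelLowerSet_faces hs).1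
    exact ⟨i, (hcover s hs i hi).resolve_right (hnot s hs x ⟨hx, hxs⟩ _ (hvert s i hi) hxU),
      hsing s hs i hi⟩
  · obtain ⟨x, ⟨hx, s, hs, hxs⟩, hxV⟩ := hneV
    obtain ⟨i, hi⟩ := (L.isRelLowerSet_faces hs).1
    exact ⟨i, (hcover s hs i hi).resolve_left
      fun h => hnot s hs _ (hvert s i hi) x ⟨hx, hxs⟩ h hxV, hsing s hs i hi⟩

/-- The paths that enter the unit cube below `v` and there have a coordinate in `A` which differs
from that of `v`. -/
def pathsApproaching {n : ℕ} (K : Set (Fin n → ℝ)) (v : Fin n → ℝ) (A : Set (Fin n)) :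
    Set C(unitInterval, K) :=
  {γ | ∃ t, (∀ j, v j - 1 < (γ t : Fin n → ℝ) j) ∧ ∃ i ∈ A, (γ t : Fin n → ℝ) i < v i}

/-- For fixed `t` and `i` the conditions are finitely many strict inequalities on the evaluation at
`t`, which is continuous in the compact-open topology. -/
theorem isOpen_pathsApproaching {n : ℕ} (K : Set (Fin n → ℝ)) (v : Fin n → ℝ)
    (A : Set (Fin n)) : IsOpen (pathsApproaching K v A) := by
  have hev : ∀ (t : unitInterval) (j : Fin n),
      Continuous fun γ : C(unitInterval, K) => (γ t : Fin n → ℝ) j := fun t j =>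
    (continuous_apply j).comp (continuous_subtype_val.comp (continuous_eval_const t))
  simp only [pathsApproaching, Set.ofPred_exists, Set.ofPred_and, Set.ofPred_forall]
  refine isOpen_iUnion fun t => (isOpen_iInter_of_finite fun j =>
    isOpen_lt continuous_const (hev t j)).inter (isOpen_iUnion fun i => ?_)
  exact isOpen_const.inter (isOpen_lt (hev t i) continuous_const)

/-- For each vertex `i` of the past link there is a dipath to `v` that approaches `v` along the
`i`-th coordinate. -/
theorem exists_mem_pathsApproaching {n : ℕ} {K : Set (Fin n → ℝ)} {v : Fin n → ℝ}
    {A : Set (Fin n)} {i : Fin n} (hiA : i ∈ A)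
    (hi : {i} ∈ pastLink (reachableSubcomplex K 0) 0 v) :
    (dipathSpace K 0 v ∩ pathsApproaching K v A).Nonempty := by
  obtain ⟨-, hsub⟩ := hi
  have hle : v - zeroOneVector {i} ≤ v := fun j => by
    by_cases h : j = i <;> simp [zeroOneVector, h]
  obtain ⟨⟨C, ⟨-, hC⟩, hmem⟩, -⟩ := hsub (Set.left_mem_Icc.2 hle)
  -- Finish along the edge in direction `i`; its midpoint is short of `v` by 1/2 in coordinate `i`
  -- only.
  obtain ⟨δ, hδ, t, ht⟩ := exists_dipath_extend (hC _ hmem) hle fun x hx =>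
    reachableSubcomplex_subset K 0 (hsub hx).1
  refine ⟨δ, hδ, t, fun j => ?_, i, hiA, ?_⟩
  · rw [ht]
    by_cases h : j = i <;> (simp [zeroOneVector, h]; try linarith)
  · rw [ht]
    simp [zeroOneVector]
    linarith

theorem mainTheorem3 {n : ℕ} (K : Set (Fin n → ℝ)) (hK : IsEuclideanCubicalComplex K)
    (h0 : 0 ∈ cubicalVertices K) (v : Fin n → ℝ)
    (hv : v ∈ cubicalVertices (reachableSubcomplex K 0))
    (hlink : ¬ IsPreconnected (geometricRealization (pastLink (reachableSubcomplex K 0) 0 v))) :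
    ¬ IsPreconnected (dipathSpace K 0 v) := by
  classical
  obtain ⟨-, p, rfl⟩ := hv
  obtain ⟨A, B, ⟨a, haA, ha⟩, ⟨b, hbB, hb⟩, hAB⟩ := exists_vertex_separation hlink
  -- Ensures that paths from `0` do not start above `v`.
  have hpos : (0 : ℝ) < p a := by
    have hle : (fun i => (p i : ℝ)) - zeroOneVector {a} ≤ fun i => (p i : ℝ) := fun j => by
      by_cases h : j = a <;> simp [zeroOneVector, h]
    have h := (ha.2 (Set.left_mem_Icc.2 hle)).2.1 a
    simp [zeroOneVector] at h
    exact_mod_cast h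
  intro hconn
  obtain ⟨γ, hγ, ⟨t, ht, i, hiA, hi⟩, s, hs, j, hjB, hj⟩ := hconn _ _
    (isOpen_pathsApproaching K _ A) (isOpen_pathsApproaching K _ B) (fun γ hγ => by
      obtain ⟨t, ht, i, hi⟩ := exists_apply_near γ (m := fun i => (p i : ℝ))
        ⟨a, by rw [hγ.2.1]; exact hpos⟩ hγ.2.2.ge
      exact ((hAB _ (mem_pastLink_of_dipath hK hγ ht ⟨i, hi⟩)).1 i (by simpa using hi)).imp
        (fun h => ⟨t, ht, i, h, hi⟩) fun h => ⟨t, ht, i, h, hi⟩)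
    (exists_mem_pathsApproaching haA ha) (exists_mem_pathsApproaching hbB hb)
  -- At the earlier of the two times both `i` and `j` are unfinished, so one simplex would meet `A`
  -- and `B`.
  rcases le_total t s with hts | hst
  · exact (hAB _ (mem_pastLink_of_dipath hK hγ ht ⟨i, hi⟩)).2 i (by simpa using hi) j
      (by simpa using (hγ.1 j hts).trans_lt hj) hiA hjB
  · exact (hAB _ (mem_pastLink_of_dipath hK hγ hs ⟨j, hj⟩)).2 i
      (by simpa using (hγ.1 i hst).trans_lt hi) j (by simpa using hj) hiA hjB
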